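/- Let $n$ be a natural number and let $\mathbb{K}=\mathbb{C}$ or $\mathbb{R}$. For a subgroup $G$ of $GL(n,\mathbb{K})$ and $v\in\mathbb{K}^n$ let $G(v)=\{Av : A\in G\}$ be the orbit of $v$ under the natural linear action. An orbit $\gamma\subset\mathbb{K}^n$ is called regular of order $m$ if for every $w\in\gamma$ there is an open set $O\subset\mathbb{K}^n$ containing $w$ such that $\overline{\gamma}\cap O$ is a smooth embedded submanifold (without boundary) of dimension $m$ over $\mathbb{R}$ of $\mathbb{K}^n$, where $\mathbb{C}^n$ is regarded as the real vector space $\mathbb{R}^{2n}$. If $G$ is an abelian subgroup of $GL(n,\mathbb{C})$ (respectively $GL(n,\mathbb{R})$), then for every $v\in\mathbb{C}^n$ (respectively $v\in\mathbb{R}^n$) there is an integer $m$ with $0\le m\le 2n$ (respectively $0\le m\le n$) such that the orbit $G(v)$ is regular of order $m$. -/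

import Mathlib

open scoped ContDiff Matrix

/-- The orbit `G(v) = {A v : A ∈ G}` of a vector `v ∈ 𝕜ⁿ` under a subgroup `G` of `GL(n, 𝕜)`, for the
natural linear action. -/
def linearOrbit {𝕜 : Type*} [Field 𝕜] {n : ℕ} (G : Subgroup (GL (Fin n) 𝕜)) (v : Fin n → 𝕜) :
    Set (Fin n → 𝕜) :=
  {w | ∃ A ∈ G, (A : Matrix (Fin n) (Fin n) 𝕜) *ᵥ v = w}

/-- `S` is a (smooth, embedded, boundaryless) real submanifold of dimension `m` of the real normed
space `E`: around each of its points there is a smooth chart `φ` of `E`, defined on an open set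
`φ.source`, with smooth inverse, that carries `S ∩ φ.source` onto the part of an `m`-dimensional real
linear subspace `V` of `E` inside the open set `φ.target`. -/
def IsSmoothSubmanifold {E : Type*} [NormedAddCommGroup E] [NormedSpace ℝ E] (m : ℕ) (S : Set E) :
    Prop :=
  ∀ p ∈ S, ∃ (φ : OpenPartialHomeomorph E E) (V : Submodule ℝ E),
    p ∈ φ.source ∧ ContDiffOn ℝ ∞ φ φ.source ∧ ContDiffOn ℝ ∞ φ.symm φ.target ∧
      FiniteDimensional ℝ V ∧ Module.finrank ℝ V = m ∧
      φ '' (S ∩ φ.source) = (V : Set E) ∩ φ.target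

/-- The set `γ` is regular of order `m`: every `v ∈ γ` lies in an open set `O` such that
`closure γ ∩ O` is a real manifold of dimension `m`. -/
def IsRegularOfOrder {E : Type*} [NormedAddCommGroup E] [NormedSpace ℝ E] (m : ℕ) (γ : Set E) :
    Prop :=
  ∀ v ∈ γ, ∃ O : Set E, IsOpen O ∧ v ∈ O ∧ IsSmoothSubmanifold m (closure γ ∩ O)

/-! Since `G` is abelian, the real algebra `R` it generates is commutative and finite-dimensional.
The kernel of `a ↦ a v` is then an ideal `I`, so the orbit is an injective linear image of a group
`H` of units of `R ⧸ I`. The elements whose exponential lies in the closure of `H` form a closed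
additive subgroup, which near `0` is a linear subspace `V`. For every unit `b` in the closure, `x ↦
b * exp x` straightens the closure near `b` to the same `V`, so `m = dim V` at every point. -/

open Filter Topology in
/-- A closed additive subgroup of a finite-dimensional real vector space coincides near the origin
with a linear subspace. -/
theorem AddSubgroup.exists_submodule_mem_iff_of_norm_lt {F : Type*} [NormedAddCommGroup F]
    [NormedSpace ℝ F] [FiniteDimensional ℝ F] (L : AddSubgroup F) (hL : IsClosed (L : Set F)) :
    ∃ (V : Submodule ℝ F) (ε : ℝ), 0 < ε ∧ ∀ x, ‖x‖ < ε → (x ∈ L ↔ x ∈ V) := by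
  let V : Submodule ℝ F :=
    { carrier := {x | ∀ t : ℝ, t • x ∈ L}
      add_mem' := fun {x y} hx hy t => by
        rw [smul_add]; exact L.add_mem (hx t) (hy t)
      zero_mem' := fun t => by rw [smul_zero]; exact L.zero_mem
      smul_mem' := fun c x hx t => by rw [smul_smul]; exact hx (t * c) }
  have hVL : ∀ x ∈ V, x ∈ L := fun x hx => by simpa using hx 1
  refine ⟨V, ?_⟩
  by_contra! hcon
  have hcon' : ∀ k : ℕ, ∃ x, ‖x‖ < 1 / ((k : ℝ) + 1) ∧ x ∈ L ∧ x ∉ V := fun k => by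
    obtain ⟨x, hx, h⟩ := hcon (1 / ((k : ℝ) + 1)) (by positivity)
    rcases h with h | h
    · exact ⟨x, hx, h⟩
    · exact absurd (hVL x h.2) h.1
  choose x hx hxL hxV using hcon'
  obtain ⟨P, hP⟩ := LinearMap.exists_leftInverse_of_injective V.subtype V.ker_subtype
  have hPV : ∀ z : V, P z = z := fun z => LinearMap.congr_fun hP z
  have hPc : Continuous P := P.continuous_of_finiteDimensional
  -- Removing the `V`-component stays in `L`, as `V ⊆ L`, so the limit direction of `y` lies in `ker
  -- P`, a complement of `V`.
  let y : ℕ → F := fun k => x k - P (x k)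
  have hyL : ∀ k, y k ∈ L := fun k => L.sub_mem (hxL k) (hVL _ (P (x k)).2)
  have hy0 : ∀ k, y k ≠ 0 := fun k h => hxV k <| by
    rw [sub_eq_zero.1 h]; exact (P (x k)).2
  have hPy : ∀ k, P (y k) = 0 := fun k => by simp [y, hPV]
  have hxt : Tendsto x atTop (𝓝 0) :=
    squeeze_zero_norm (fun k => (hx k).le) tendsto_one_div_add_atTop_nhds_zero_nat
  have hyt : Tendsto y atTop (𝓝 0) := by
    have h : Continuous fun z : F => z - P z := by fun_prop
    simpa using! (h.tendsto 0).comp hxt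
  have hsphere : ∀ k, ‖y k‖⁻¹ • y k ∈ Metric.sphere (0 : F) 1 := fun k => by
    rw [mem_sphere_zero_iff_norm, norm_smul, norm_inv, norm_norm,
      inv_mul_cancel₀ (norm_ne_zero_iff.2 (hy0 k))]
  have := FiniteDimensional.proper_real F
  obtain ⟨u, hu, φ, hφ, hlim⟩ := (isCompact_sphere (0 : F) 1).tendsto_subseq hsphere
  have hPu : P u = 0 := by
    refine tendsto_nhds_unique ((hPc.tendsto u).comp hlim) ?_
    simp [Function.comp_def, hPy]
  have huV : u ∈ V := fun t => by
    -- As `y` tends to `0`, integer multiples of `y (φ k)` approximate every point of the line `ℝ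
    -- u`.
    refine hL.mem_of_tendsto (b := atTop)
      (f := fun k => ⌊t / ‖y (φ k)‖⌋ • y (φ k)) ?_
      (Eventually.of_forall fun k => L.zsmul_mem (hyL _) _)
    have h1 : Tendsto (fun k => t • (‖y (φ k)‖⁻¹ • y (φ k))) atTop (𝓝 (t • u)) :=
      hlim.const_smul t
    have h2 : Tendsto (fun k => Int.fract (t / ‖y (φ k)‖) • y (φ k)) atTop (𝓝 0) := by
      refine squeeze_zero_norm (fun k => ?_) (by simpa using (hyt.comp hφ.tendsto_atTop).norm)
      rw [norm_smul, Real.norm_of_nonneg (Int.fract_nonneg _)]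
      exact mul_le_of_le_one_left (norm_nonneg _) (Int.fract_lt_one _).le
    refine (by simpa using h1.sub h2 :
      Tendsto _ atTop (𝓝 (t • u))).congr fun k => ?_
    rw [smul_smul, ← div_eq_mul_inv, ← sub_smul, Int.self_sub_fract, Int.cast_smul_eq_zsmul]
  have : u = 0 := by simpa [hPu] using (congrArg Subtype.val (hPV ⟨u, huV⟩)).symm
  simp [this] at hu

namespace Subgroup

variable {A : Type*} [NormedCommRing A] (H : Subgroup Aˣ)

theorem mul_mem_closure_image_val {a b : A} (ha : a ∈ _root_.closure (Units.val '' (H : Set Aˣ)))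
    (hb : b ∈ _root_.closure (Units.val '' (H : Set Aˣ))) :
    a * b ∈ _root_.closure (Units.val '' (H : Set Aˣ)) :=
  map_mem_closure₂ continuous_mul ha hb <| by
    rintro _ ⟨g, hg, rfl⟩ _ ⟨h, hh, rfl⟩
    exact ⟨g * h, H.mul_mem hg hh, rfl⟩

theorem inv_mem_closure_image_val [CompleteSpace A] {u : Aˣ}
    (hu : (u : A) ∈ _root_.closure (Units.val '' (H : Set Aˣ))) :
    ((u⁻¹ : Aˣ) : A) ∈ _root_.closure (Units.val '' (H : Set Aˣ)) := by
  rw [← Ring.inverse_unit]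
  refine _root_.closure_mono ?_ (mem_closure_image (NormedRing.inverse_continuousAt u) hu)
  rintro _ ⟨_, ⟨h, hh, rfl⟩, rfl⟩
  exact ⟨h⁻¹, H.inv_mem hh, (Ring.inverse_unit h).symm⟩

/-- This homogeneity moves the local question at a unit of the closure to the identity. -/
theorem mul_mem_closure_image_val_iff [CompleteSpace A] {u : Aˣ}
    (hu : (u : A) ∈ _root_.closure (Units.val '' (H : Set Aˣ))) (a : A) :
    u * a ∈ _root_.closure (Units.val '' (H : Set Aˣ)) ↔
      a ∈ _root_.closure (Units.val '' (H : Set Aˣ)) :=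
  ⟨fun h => by simpa using H.mul_mem_closure_image_val (H.inv_mem_closure_image_val hu) h,
    fun h => H.mul_mem_closure_image_val hu h⟩

variable [NormedAlgebra ℝ A] [CompleteSpace A]

/-- The elements of a commutative Banach algebra whose exponential lies in the closure of a
subgroup of the group of units. -/
def expPreimageClosure : AddSubgroup A :=
  letI := NormedAlgebra.restrictScalars ℚ ℝ A
  { carrier := {x | NormedSpace.exp x ∈ _root_.closure (Units.val '' (H : Set Aˣ))}
    add_mem' := fun {x y} hx hy => by
      simpa [NormedSpace.exp_add] using H.mul_mem_closure_image_val hx hy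
    zero_mem' := by
      rw [Set.mem_ofPred_eq, NormedSpace.exp_zero]
      exact _root_.subset_closure ⟨1, H.one_mem, rfl⟩
    neg_mem' := fun {x} hx => by
      obtain ⟨u, hu⟩ := NormedSpace.isUnit_exp x
      rw [Set.mem_ofPred_eq, ← hu] at hx
      have h := H.inv_mem_closure_image_val hx
      rwa [← Ring.inverse_unit, hu, Ring.inverse_exp] at h }

theorem mem_expPreimageClosure {x : A} : x ∈ H.expPreimageClosure ↔
    NormedSpace.exp x ∈ _root_.closure (Units.val '' (H : Set Aˣ)) :=
  Iff.rfl

theorem isClosed_expPreimageClosure : IsClosed (H.expPreimageClosure : Set A) :=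
  letI := NormedAlgebra.restrictScalars ℚ ℝ A
  isClosed_closure.preimage NormedSpace.exp_continuous

end Subgroup

section ExpChart

variable {A E : Type*} [NormedCommRing A] [NormedAlgebra ℝ A]
  [NormedAddCommGroup E] [NormedSpace ℝ E] (ι : A →L[ℝ] E) (π : E →L[ℝ] A)

/-- Given a continuous linear embedding `ι` of a commutative Banach algebra with left inverse `π`,
this is the self-map of the ambient space that is `x ↦ b * exp x` along the algebra and the identity
along the kernel of `π`. -/
noncomputable def expChart (b : A) (x : E) : E :=
  ι (b * NormedSpace.exp (π x)) + (x - ι (π x))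

theorem contDiff_expChart [CompleteSpace A] (b : A) : ContDiff ℝ ∞ (expChart ι π b) := by
  have h : ContDiff ℝ ∞ (NormedSpace.exp : A → A) :=
    contDiff_iff_contDiffAt.2 fun x => (NormedSpace.exp_analytic (𝕂 := ℝ) x).contDiffAt
  unfold expChart
  fun_prop

variable {ι π}

theorem map_expChart (hπ : ∀ a, π (ι a) = a) (b : A) (x : E) :
    π (expChart ι π b x) = b * NormedSpace.exp (π x) := by
  simp [expChart, hπ]

/-- The linear automorphism of `E` that is multiplication by the unit `u` along the range of `ι` and
the identity along the kernel of `π`. -/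
noncomputable def unitExtension (hπ : ∀ a, π (ι a) = a) (u : Aˣ) : E ≃L[ℝ] E :=
  ContinuousLinearEquiv.equivOfInverse
    (ι ∘L ((u : A) • ContinuousLinearMap.id ℝ A) ∘L π + (ContinuousLinearMap.id ℝ E - ι ∘L π))
    (ι ∘L (((u⁻¹ : Aˣ) : A) • ContinuousLinearMap.id ℝ A) ∘L π +
      (ContinuousLinearMap.id ℝ E - ι ∘L π))
    (fun x => by simp [hπ]) (fun x => by simp [hπ])

theorem hasFDerivAt_expChart [CompleteSpace A] (hπ : ∀ a, π (ι a) = a) {b : A} {x : E} {u : Aˣ}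
    (hu : (u : A) = b * NormedSpace.exp (π x)) :
    HasFDerivAt (expChart ι π b) (unitExtension hπ u : E →L[ℝ] E) x := by
  have h1 := (((hasFDerivAt_exp (𝕂 := ℝ) (x := π x)).comp x π.hasFDerivAt).const_mul b)
  have h2 := (ι.hasFDerivAt.comp x h1).add
    ((hasFDerivAt_id x).sub (ι.hasFDerivAt.comp x π.hasFDerivAt))
  refine h2.congr_fderiv ?_
  ext y
  simp [unitExtension, hu, mul_assoc]

/-- The derivative is invertible at every point, not only at `0`, so the local inverse is smooth on
its whole target. -/
theorem exists_expChart_openPartialHomeomorph [CompleteSpace A] [CompleteSpace E]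
    (hπ : ∀ a, π (ι a) = a) (b : Aˣ) :
    ∃ Φ : OpenPartialHomeomorph E E, ⇑Φ = expChart ι π b ∧ 0 ∈ Φ.source ∧
      ContDiffOn ℝ ∞ Φ.symm Φ.target := by
  let := NormedAlgebra.restrictScalars ℚ ℝ A
  have hunit : ∀ x : E, ∃ u : Aˣ, (u : A) = b * NormedSpace.exp (π x) := fun x =>
    b.isUnit.mul (NormedSpace.isUnit_exp (π x))
  have hc := fun x => (contDiff_expChart ι π (b : A)).contDiffAt (x := x)
  obtain ⟨u, hu⟩ := hunit 0
  refine ⟨(hc 0).toOpenPartialHomeomorph _ (hasFDerivAt_expChart hπ hu) (by simp), rfl,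
    ContDiffAt.mem_toOpenPartialHomeomorph_source _ _ _, fun y hy => ?_⟩
  obtain ⟨w, hw⟩ := hunit
    (((hc 0).toOpenPartialHomeomorph _ (hasFDerivAt_expChart hπ hu) (by simp)).symm y)
  exact (OpenPartialHomeomorph.contDiffAt_symm _ hy (hasFDerivAt_expChart hπ hw)
    (hc _)).contDiffWithinAt

end ExpChart

/-- The image of a subgroup of the group of units of a commutative finite-dimensional real algebra
under a linear embedding is regular. -/
theorem Subgroup.exists_isRegularOfOrder_image {A E : Type*} [NormedCommRing A] [NormedAlgebra ℝ A]
    [FiniteDimensional ℝ A] [NormedAddCommGroup E] [NormedSpace ℝ E] [FiniteDimensional ℝ E]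
    (H : Subgroup Aˣ) (ι : A →ₗ[ℝ] E) (hι : Function.Injective ι) :
    ∃ m ≤ Module.finrank ℝ E, IsRegularOfOrder m (ι '' (Units.val '' (H : Set Aˣ))) := by
  have := FiniteDimensional.complete ℝ A
  have := FiniteDimensional.complete ℝ E
  obtain ⟨V, ε, hε, hV⟩ := H.expPreimageClosure.exists_submodule_mem_iff_of_norm_lt
    H.isClosed_expPreimageClosure
  have hVm : Module.finrank ℝ (V.map ι) = Module.finrank ℝ V :=
    (V.equivMapOfInjective ι hι).finrank_eq.symm
  refine ⟨Module.finrank ℝ V, hVm ▸ Submodule.finrank_le _, ?_⟩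
  obtain ⟨π, hπ'⟩ := LinearMap.exists_leftInverse_of_injective ι (LinearMap.ker_eq_bot.2 hι)
  have hπ : ∀ a, π.toContinuousLinearMap (ι.toContinuousLinearMap a) = a :=
    fun a => LinearMap.congr_fun hπ' a
  have hπι : ∀ a, π (ι a) = a := hπ
  have hclos : _root_.closure (ι '' (Units.val '' (H : Set Aˣ))) =
      ι '' _root_.closure (Units.val '' (H : Set Aˣ)) :=
    (LinearMap.isClosedEmbedding_of_injective (LinearMap.ker_eq_bot.2 hι)).closure_image_eq _
  rintro _ ⟨_, ⟨h, hh, rfl⟩, rfl⟩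
  -- The closure may contain non-units, where translation fails; this open set discards them.
  refine ⟨π ⁻¹' {a | IsUnit a}, Units.isOpen.preimage π.continuous_of_finiteDimensional,
    by simp [hπι], ?_⟩
  rw [hclos]
  rintro _ ⟨⟨b, hb, rfl⟩, hbu⟩
  obtain ⟨b, rfl⟩ : IsUnit b := by simpa [hπι] using hbu
  obtain ⟨Φ, hΦ, hΦ0, hΦs⟩ := exists_expChart_openPartialHomeomorph hπ b
  -- On this set `π x` stays in the ball where the additive subgroup agrees with `V`.
  have hopen : IsOpen (π ⁻¹' Metric.ball 0 ε) :=
    Metric.isOpen_ball.preimage π.continuous_of_finiteDimensional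
  let Ψ := Φ.restrOpen _ hopen
  have hΨs : Ψ.source = Φ.source ∩ π ⁻¹' Metric.ball 0 ε := rfl
  have hΨ : ⇑Ψ = expChart ι.toContinuousLinearMap π.toContinuousLinearMap b := hΦ
  have hΨt : Ψ.target ⊆ Φ.target := fun y hy => by
    rw [← Ψ.right_inv hy]; exact Φ.map_source (Ψ.map_target hy).1
  have h0 : (0 : E) ∈ Ψ.source := ⟨hΦ0, by simpa using hε⟩
  have hΨ0 : Ψ 0 = ι b := by simp [hΨ, expChart]
  refine ⟨Ψ.symm, V.map ι, ?_, hΦs.mono hΨt, ?_, inferInstance, hVm, ?_⟩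
  · rw [← hΨ0]; exact Ψ.map_source h0
  · simp only [OpenPartialHomeomorph.symm_symm, hΨ]
    exact (contDiff_expChart _ _ _).contDiffOn
  have key : ∀ x ∈ Ψ.source, (Ψ x ∈ ι '' _root_.closure (Units.val '' (H : Set Aˣ)) ∩
      π ⁻¹' {a | IsUnit a} ↔ x ∈ V.map ι) := fun x hx => by
    let := NormedAlgebra.restrictScalars ℚ ℝ A
    have hπΨ : π (Ψ x) = b * NormedSpace.exp (π x) := by
      rw [hΨ]; exact map_expChart hπ _ x
    have hΨx : Ψ x = ι (π (Ψ x)) + (x - ι (π x)) := by rw [hπΨ, hΨ]; rfl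
    have hmem : π x ∈ V ↔ π (Ψ x) ∈ _root_.closure (Units.val '' (H : Set Aˣ)) := by
      rw [← hV _ (by simpa using hx.2), H.mem_expPreimageClosure, hπΨ,
        H.mul_mem_closure_image_val_iff hb]
    constructor
    · rintro ⟨⟨a, ha, hax⟩, -⟩
      have haΨ : π (Ψ x) = a := by rw [← hax, hπι]
      refine ⟨π x, hmem.2 (haΨ ▸ ha), ?_⟩
      rw [haΨ, ← hax] at hΨx
      exact (sub_eq_zero.1 (left_eq_add.1 hΨx)).symm
    · rintro ⟨a, ha, rfl⟩
      refine ⟨⟨π (Ψ (ι a)), hmem.1 (by rwa [hπι]), ?_⟩, ?_⟩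
      · conv_rhs => rw [hΨx]
        simp [hπι]
      · rw [Set.mem_preimage, hπΨ]
        exact b.isUnit.mul (NormedSpace.isUnit_exp _)
  ext x
  constructor
  · rintro ⟨y, ⟨hyS, hy⟩, rfl⟩
    have hx := Ψ.map_target hy
    exact ⟨(key _ hx).1 (by rwa [Ψ.right_inv hy]), hx⟩
  · rintro ⟨hxV, hx⟩
    exact ⟨Ψ x, ⟨(key x hx).2 hxV, Ψ.map_source hx⟩, Ψ.left_inv hx⟩

/-- The image of a subgroup of the group of units of a commutative finite-dimensional real algebra
under a linear map whose kernel is an ideal is regular. -/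
theorem Subgroup.exists_isRegularOfOrder_image_of_ideal_ker {A E : Type*} [NormedCommRing A]
    [NormedAlgebra ℝ A] [FiniteDimensional ℝ A] [NormedAddCommGroup E] [NormedSpace ℝ E]
    [FiniteDimensional ℝ E] (H : Subgroup Aˣ) (ev : A →ₗ[ℝ] E)
    (hev : ∀ a b, ev b = 0 → ev (a * b) = 0) :
    ∃ m ≤ Module.finrank ℝ E, IsRegularOfOrder m (ev '' (Units.val '' (H : Set Aˣ))) := by
  let I : Ideal A :=
    { carrier := {a | ev a = 0}
      add_mem' := fun {a b} (ha : ev a = 0) (hb : ev b = 0) =>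
        show ev (a + b) = 0 by rw [map_add, ha, hb, add_zero]
      zero_mem' := map_zero ev
      smul_mem' := hev }
  have hI : IsClosed (I : Set A) :=
    isClosed_eq ev.continuous_of_finiteDimensional continuous_const
  let ι : (A ⧸ I) →ₗ[ℝ] E := (I.restrictScalars ℝ).liftQ ev fun a ha => ha
  have hι : Function.Injective ι :=
    LinearMap.ker_eq_bot.1 (Submodule.ker_liftQ_eq_bot _ _ _ fun a ha => ha)
  have : FiniteDimensional ℝ (A ⧸ I) :=
    Module.Finite.of_surjective (Ideal.Quotient.mkₐ ℝ I).toLinearMap Ideal.Quotient.mk_surjective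
  obtain ⟨m, hm, hreg⟩ :=
    (H.map (Units.map (Ideal.Quotient.mk I).toMonoidHom)).exists_isRegularOfOrder_image ι hι
  refine ⟨m, hm, ?_⟩
  convert! hreg using 1
  ext w
  constructor
  · rintro ⟨_, ⟨u, hu, rfl⟩, rfl⟩
    exact ⟨_, ⟨_, ⟨u, hu, rfl⟩, rfl⟩, rfl⟩
  · rintro ⟨_, ⟨_, ⟨u, hu, rfl⟩, rfl⟩, rfl⟩
    exact ⟨_, ⟨u, hu, rfl⟩, rfl⟩

section Matrix

attribute [local instance] Matrix.linftyOpNormedRing Matrix.linftyOpNormedAlgebra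

/-- Every orbit of an abelian group of real or complex matrices is regular. -/
theorem exists_isRegularOfOrder_linearOrbit {𝕜 : Type*} [RCLike 𝕜] {n : ℕ}
    (G : Subgroup (GL (Fin n) 𝕜)) (hG : ∀ A ∈ G, ∀ B ∈ G, A * B = B * A) (v : Fin n → 𝕜) :
    ∃ m ≤ Module.finrank ℝ (Fin n → 𝕜), IsRegularOfOrder m (linearOrbit G v) := by
  let S : Set (Matrix (Fin n) (Fin n) 𝕜) := Units.val '' (G : Set (GL (Fin n) 𝕜))
  have hS : ∀ a ∈ S, ∀ b ∈ S, a * b = b * a := by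
    rintro _ ⟨a, ha, rfl⟩ _ ⟨b, hb, rfl⟩
    exact congrArg Units.val (hG a ha b hb)
  let R := Algebra.adjoin ℝ S
  have hR : IsMulCommutative R := Algebra.isMulCommutative_adjoin ℝ hS
  let : NormedCommRing R :=
    { (inferInstance : NormedRing R) with mul_comm := fun a b => hR.is_comm.comm a b }
  let : NormedAlgebra ℝ R := Subalgebra.toNormedAlgebra R
  let ev : R →ₗ[ℝ] (Fin n → 𝕜) :=
    { toFun := fun a => (a : Matrix (Fin n) (Fin n) 𝕜) *ᵥ v
      map_add' := fun a b => Matrix.add_mulVec _ _ _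
      map_smul' := fun c a => Matrix.smul_mulVec _ _ _ }
  have hev : ∀ a b : R, ev b = 0 → ev (a * b) = 0 := fun a b hb =>
    (Matrix.mulVec_mulVec v (a : Matrix (Fin n) (Fin n) 𝕜) b).symm.trans <|
      (congrArg _ hb).trans (Matrix.mulVec_zero _)
  let H : Subgroup Rˣ := G.comap (Units.map R.val.toMonoidHom)
  obtain ⟨m, hm, hreg⟩ := H.exists_isRegularOfOrder_image_of_ideal_ker ev hev
  refine ⟨m, hm, ?_⟩
  convert! hreg using 1
  ext w
  constructor
  · rintro ⟨g, hg, rfl⟩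
    -- `g` is a unit of `R` itself because `g⁻¹` is also among the generators.
    let u : Rˣ :=
      { val := ⟨g, Algebra.subset_adjoin ⟨g, hg, rfl⟩⟩
        inv := ⟨(g⁻¹ : GL (Fin n) 𝕜), Algebra.subset_adjoin ⟨g⁻¹, G.inv_mem hg, rfl⟩⟩
        val_inv := Subtype.ext g.mul_inv
        inv_val := Subtype.ext g.inv_mul }
    have hu : Units.map R.val.toMonoidHom u = g := Units.ext rfl
    exact ⟨_, ⟨u, show _ ∈ G from hu.symm ▸ hg, rfl⟩, rfl⟩
  · rintro ⟨_, ⟨u, hu, rfl⟩, rfl⟩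
    exact ⟨_, hu, rfl⟩

end Matrix

theorem corollaryC (n : ℕ) :
    (∀ G : Subgroup (GL (Fin n) ℂ), (∀ A ∈ G, ∀ B ∈ G, A * B = B * A) →
      ∀ v : Fin n → ℂ, ∃ m : ℕ, 0 ≤ m ∧ m ≤ 2 * n ∧ IsRegularOfOrder m (linearOrbit G v)) ∧
    (∀ G : Subgroup (GL (Fin n) ℝ), (∀ A ∈ G, ∀ B ∈ G, A * B = B * A) →
      ∀ v : Fin n → ℝ, ∃ m : ℕ, 0 ≤ m ∧ m ≤ n ∧ IsRegularOfOrder m (linearOrbit G v)) := by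
  refine ⟨fun G hG v => ?_, fun G hG v => ?_⟩
  · obtain ⟨m, hm, h⟩ := exists_isRegularOfOrder_linearOrbit G hG v
    rw [Module.finrank_pi_fintype] at hm
    exact ⟨m, m.zero_le, by simpa [mul_comm] using hm, h⟩
  · obtain ⟨m, hm, h⟩ := exists_isRegularOfOrder_linearOrbit G hG v
    exact ⟨m, m.zero_le, by simpa using hm, h⟩
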